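/- **Theorem ($\mathsf{BQP}$-security of the superposition-resistant Yao protocol).** *Machines.* A $\mathsf{BQP}$ machine is an interactive quantum machine with polynomially many (in the security parameter $\eta$) private qubits whose activations are quantum circuits (gates $H$, $T$, $\mathrm{CNOT}$, fresh $|0\rangle$ qubits, discarding of qubits) from polynomial-time uniform families; it may send and receive arbitrary quantum states. *Protocol.* For each $\eta$ let $f:\{0,1\}^{n_X}\times\{0,1\}^{n_Y}\to\{0,1\}$ be a function and $(\mathsf{Enc},\mathsf{Dec})$ a symmetric encryption scheme with keys in $\{0,1\}^{n_K}$, auxiliary values in $\{0,1\}^{n_A}$ and messages and ciphertexts in $\{0,1\}^{p+1}$, such that $\mathsf{Dec}_k(\mathrm{aux},\mathsf{Enc}_k(\mathrm{aux},m))=m$, whose decryption is performed in place by the unitary $|k\rangle|\mathrm{aux}\rangle|c\rangle\mapsto|d_K(k)\rangle|d_A(\mathrm{aux})\rangle|\mathsf{Dec}_k(\mathrm{aux},c)\rangle$ for permutations $d_K,d_A$ (all parameters may depend on $\eta$). In the superposition-resistant Yao protocol, in the OT-hybrid model, the Garbler (input $x\in\{0,1\}^{n_X}$) and the Evaluator (input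 $y\in\{0,1\}^{n_Y}$) proceed as follows. 1. They call $n_Y$ times a classical trusted party for $1$-out-of-$2$ string oblivious transfer (OT). In call $i$ the Garbler inputs two keys $(k_0,k_1)$, or $\mathsf{Abort}$; this input is measured in the computational basis. On $\mathsf{Abort}$ both parties are told $\mathsf{Abort}$; otherwise the Evaluator receives $k_{y_i}$ and the Garbler receives nothing. 2. The Garbler sends, over a quantum channel, a garbled table with $2^{n_X+n_Y}$ entries of $p+1$ qubits, the $n_X$ keys for its own input, and the $n_X+n_Y$ auxiliary values. It has no further interaction with the Evaluator and has no output. 3. The Evaluator decrypts the entries of the table one after the other in place, and after each decryption measures whether the last $p$ qubits are $0^p$. If so, it stops and its output is the remaining qubit of the entry; if not, it undoes $d_K$ and $d_A$ on the keys and auxiliary values and continues with the next entry. If no entry is left, or if it has not obtained all of its keys from the OTs, its output is $\mathsf{Abort}$. The Evaluator keeps its output and never communicates whether it has aborted. *Executions.* An Environment $\mathcal Z$ prepares the input $y$ of the Evaluator, measured in the computational basis, and the initial quantum memory $\rho_{\mathcal A}$ of the Adversary $\mathcal A$, who plays the Garbler and may deviate arbitrarily. In the real execution $\mathcal A$ interacts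 with the Evaluator with input $y$ and the OT trusted party. In the ideal execution $\mathcal A$ interacts with a Simulator $\mathcal S$ instead, who is not given $y$ and has single-query access to the ideal functionality $\mathcal F_f$: this measures the query $x$ in the computational basis, sends $f(x,y)$ to the Evaluator only, and returns the measured $x$ to $\mathcal S$ (on the query $\mathsf{Abort}$ it sends $\mathsf{Abort}$ to both). At the end $\mathcal A$ outputs a bit $b$. *Claim.* The protocol is perfectly secure (security with $\epsilon = 0$) against a $\mathsf{BQP}$ adversarial Garbler: for all $\mathsf{BQP}$ Adversaries $\mathcal A$ and all $\mathsf{BQP}$ Environments $\mathcal Z$ there is a $\mathsf{BQP}$ Simulator $\mathcal S$ such that for every $\eta$ $$\bigl|\Pr[b=0 \text{ in the ideal execution}]-\Pr[b=0\text{ in the real execution}]\bigr|\le 0 .$$ -/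

import Mathlib

open scoped Kronecker

noncomputable section

namespace SupYao

/-! ## Quantum channels on registers -/

/-- Bit strings of length `n`; also the computational basis of a register of `n` qubits. -/
abbrev Word (n : ℕ) : Type := Fin n → Bool

/-- The all-zero string. -/
def zeroWord (n : ℕ) : Word n := fun _ => false

/-- A quantum operation (completely positive trace-preserving map), in Kraus form, from the
system with computational basis `X` to the system with computational basis `Y`. -/
structure Channel (X Y : Type) [Fintype X] [DecidableEq X] [Fintype Y] where
  ι : Type
  [fin : Fintype ι]
  kraus : ι → Matrix Y X ℂ
  tp : ∑ i, (kraus i).conjTranspose * kraus i = 1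

attribute [instance] Channel.fin

namespace Channel

variable {X Y Z R : Type} [Fintype X] [DecidableEq X] [Fintype Y] [DecidableEq Y]
  [Fintype Z] [DecidableEq Z] [Fintype R] [DecidableEq R]

/-- The action of a channel on (density) matrices. -/
def apply (Φ : Channel X Y) (ρ : Matrix X X ℂ) : Matrix Y Y ℂ :=
  ∑ i, Φ.kraus i * ρ * (Φ.kraus i).conjTranspose

/-- First `Φ`, then `Ψ`. -/
def seq (Φ : Channel X Y) (Ψ : Channel Y Z) : Channel X Z where
  ι := Φ.ι × Ψ.ι
  kraus ij := Ψ.kraus ij.2 * Φ.kraus ij.1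
  tp := by
    rw [Fintype.sum_prod_type]
    have h : ∀ i, ∑ j, (Ψ.kraus j * Φ.kraus i).conjTranspose * (Ψ.kraus j * Φ.kraus i)
        = (Φ.kraus i).conjTranspose * Φ.kraus i := by
      intro i
      have h2 : ∀ j, (Ψ.kraus j * Φ.kraus i).conjTranspose * (Ψ.kraus j * Φ.kraus i)
          = (Φ.kraus i).conjTranspose * ((Ψ.kraus j).conjTranspose * Ψ.kraus j) * Φ.kraus i := by
        intro j
        simp only [Matrix.conjTranspose_mul, Matrix.mul_assoc]
      simp only [h2]
      rw [← Matrix.sum_mul, ← Matrix.mul_sum, Ψ.tp, Matrix.mul_one]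
    simp only [h, Φ.tp]

/-- Application of a unitary. -/
def ofUnitary (U : Matrix.unitaryGroup X ℂ) : Channel X X where
  ι := Unit
  kraus _ := U.1
  tp := by
    simpa [Matrix.star_eq_conjTranspose] using Matrix.UnitaryGroup.star_mul_self U

/-- The isometry `|x⟩ ↦ |g x⟩` of an injective map `g` of basis states. -/
def ofInjective (g : X → Y) (hg : Function.Injective g) : Channel X Y where
  ι := Unit
  kraus _ := Matrix.of fun y x => if y = g x then 1 else 0
  tp := by
    ext a b
    simp [Matrix.mul_apply, Matrix.one_apply, hg.eq_iff, eq_comm]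

/-- Relabelling of basis states. -/
def ofEquiv (g : X ≃ Y) : Channel X Y := ofInjective g g.injective

/-- A classical map: measure in the computational basis, get `x`, prepare `|g x⟩`. -/
def classical (g : X → Y) : Channel X Y where
  ι := X
  kraus x := Matrix.single (g x) x 1
  tp := by
    ext a b
    simp [Matrix.sum_apply, Matrix.single_apply, Matrix.one_apply, ite_and]

/-- Discarding (tracing out) the right subsystem. -/
def discardRight : Channel (X × R) X where
  ι := R
  kraus r := Matrix.of fun x z => if z = (x, r) then 1 else 0
  tp := by
    ext ⟨a, r⟩ ⟨b, s⟩
    simp [Matrix.sum_apply, Matrix.mul_apply, Matrix.one_apply, ite_and, Finset.sum_ite_eq]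
    grind

/-- `Φ ⊗ id`. -/
def onLeft (Φ : Channel X Y) : Channel (X × R) (Y × R) where
  ι := Φ.ι
  kraus i := Φ.kraus i ⊗ₖ (1 : Matrix R R ℂ)
  tp := by
    have h : ∀ i, (Φ.kraus i ⊗ₖ (1 : Matrix R R ℂ)).conjTranspose * (Φ.kraus i ⊗ₖ (1 : Matrix R R ℂ))
        = ((Φ.kraus i).conjTranspose * Φ.kraus i) ⊗ₖ (1 : Matrix R R ℂ) := by
      intro i
      rw [Matrix.conjTranspose_kronecker, ← Matrix.mul_kronecker_mul]
      simp
    simp only [h]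
    rw [← Matrix.one_kronecker_one, ← Φ.tp]
    ext a b
    simp [Matrix.sum_apply, Finset.sum_mul]

/-- `id ⊗ Φ`. -/
def onRight (Φ : Channel X Y) : Channel (R × X) (R × Y) :=
  ((ofEquiv (Equiv.prodComm R X)).seq Φ.onLeft).seq (ofEquiv (Equiv.prodComm Y R))

/-- The two-outcome projective measurement `{P, 1 - P}`, with `P` the projector on the basis
states satisfying `P`, followed by `Φ₁` on outcome `P` and by `Φ₀` otherwise. -/
def measureThen (P : X → Bool) (Φ₁ Φ₀ : Channel X Y) : Channel X Y where
  ι := Φ₁.ι ⊕ Φ₀.ι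
  kraus := Sum.elim (fun i => Φ₁.kraus i * Matrix.diagonal fun x => if P x then (1 : ℂ) else 0)
    (fun i => Φ₀.kraus i * Matrix.diagonal fun x => if P x then (0 : ℂ) else 1)
  tp := by
    rw [Fintype.sum_sum_type]
    simp only [Sum.elim_inl, Sum.elim_inr]
    have h : ∀ (Φ : Channel X Y) (D : Matrix X X ℂ),
        ∑ i, (Φ.kraus i * D).conjTranspose * (Φ.kraus i * D) = D.conjTranspose * D := by
      intro Φ D
      have h2 : ∀ i, (Φ.kraus i * D).conjTranspose * (Φ.kraus i * D)
          = D.conjTranspose * ((Φ.kraus i).conjTranspose * Φ.kraus i) * D := by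
        intro i
        simp only [Matrix.conjTranspose_mul, Matrix.mul_assoc]
      simp only [h2]
      rw [← Matrix.sum_mul, ← Matrix.mul_sum, Φ.tp, Matrix.mul_one]
    rw [h, h, Matrix.diagonal_conjTranspose, Matrix.diagonal_conjTranspose,
      Matrix.diagonal_mul_diagonal, Matrix.diagonal_mul_diagonal, Matrix.diagonal_add,
      ← Matrix.diagonal_one]
    congr 1
    funext x
    by_cases hx : P x <;> simp [hx]

end Channel

/-! ## Quantum circuits and uniform polynomial-time families -/

/-- Gates on qubits labelled by `Q`: Hadamard, `T = diag(1, exp (iπ/4))` and `CNOT`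
(control first), a universal set. -/
inductive Gate (Q : Type) where
  | h (q : Q)
  | t (q : Q)
  | cnot (c d : Q)

section Semantics

variable {Q : Type} [Fintype Q] [DecidableEq Q]

/-- Flip the bit labelled `q`. -/
def flipBit (q : Q) (x : Q → Bool) : Q → Bool := Function.update x q (!x q)

theorem flipBit_flipBit {Q : Type} [DecidableEq Q] (q : Q) (x : Q → Bool) : flipBit q (flipBit q x) = x := by
  simp [flipBit]

theorem flipBit_ne {Q : Type} [DecidableEq Q] (q : Q) (x : Q → Bool) : flipBit q x ≠ x := by
  intro h
  have := congrFun h q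
  simp [flipBit] at this

/-- Hadamard on qubit `q`: the matrix entry `⟨x|H|y⟩` is `±1/√2` if `x` and `y` agree outside `q`
(minus exactly if both have bit `1` there) and `0` otherwise. -/
def hadamard (q : Q) : Matrix (Q → Bool) (Q → Bool) ℂ := Matrix.of fun x y =>
  if x = y then (if x q then -1 else 1) / (Real.sqrt 2 : ℂ)
  else if x = flipBit q y then 1 / (Real.sqrt 2 : ℂ) else 0

/-- `T` on qubit `q`. -/
def tMatrix (q : Q) : Matrix (Q → Bool) (Q → Bool) ℂ := Matrix.diagonal fun x =>
  if x q then Complex.exp (Complex.I * (Real.pi / 4 : ℝ)) else 1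

/-- `CNOT` on basis states. -/
def cnotMap (c d : Q) (x : Q → Bool) : Q → Bool := if x c then flipBit d x else x

/-- `CNOT` with control `c` and target `d`. -/
def cnotMatrix (c d : Q) : Matrix (Q → Bool) (Q → Bool) ℂ := Matrix.of fun x y =>
  if x = cnotMap c d y then 1 else 0

theorem hadamard_mem (q : Q) : hadamard q ∈ Matrix.unitaryGroup (Q → Bool) ℂ := by
  rw [Matrix.mem_unitaryGroup_iff', Matrix.star_eq_conjTranspose]
  have h2 : ((Real.sqrt 2 : ℝ) : ℂ) * ((Real.sqrt 2 : ℝ) : ℂ) = 2 := by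
    rw [← Complex.ofReal_mul, Real.mul_self_sqrt (by norm_num)]; norm_num
  have h0 : ((Real.sqrt 2 : ℝ) : ℂ) ≠ 0 := by
    intro h; rw [h] at h2; norm_num at h2
  have hfl : ∀ y : Q → Bool, flipBit q y q = !y q := by intro y; simp [flipBit]
  ext x y
  rw [Matrix.mul_apply]
  have key : ∀ z, (hadamard q).conjTranspose x z * hadamard q z y
      = if z = x ∨ z = flipBit q x then (hadamard q).conjTranspose x z * hadamard q z y else 0 := by
    intro z
    split_ifs with h
    · rfl
    · push Not at h
      simp [hadamard, h.1, h.2]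
  rw [Finset.sum_congr rfl (fun z _ => key z), ← Finset.sum_filter]
  have hset : (Finset.univ.filter fun z => z = x ∨ z = flipBit q x) = {x, flipBit q x} := by
    ext z; simp
  rw [hset, Finset.sum_pair (flipBit_ne q x).symm]
  have hflx := flipBit_ne q x
  have hff : ∀ a b : Q → Bool, flipBit q a = flipBit q b ↔ a = b := by
    intro a b
    constructor
    · intro h
      rw [← flipBit_flipBit q a, h, flipBit_flipBit]
    · rintro rfl; rfl
  have hfx : ∀ a b : Q → Bool, a = flipBit q b ↔ flipBit q a = b := by
    intro a b
    rw [← hff, flipBit_flipBit]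
  by_cases hxy : x = y
  · subst hxy
    cases hq : x q <;>
      · simp [hadamard, hq, hflx]
        field_simp
        rw [pow_two, h2]
        norm_num
  · by_cases hxf : flipBit q x = y
    · subst hxf
      cases hq : x q <;>
        · simp [hadamard, hq, hflx, hflx.symm, hfl, flipBit_flipBit]
          ring
    · have hyf : x ≠ flipBit q y := by rw [Ne, hfx]; exact hxf
      have e1 : hadamard q x y = 0 := by simp [hadamard, hxy, hyf]
      have e2 : hadamard q (flipBit q x) y = 0 := by simp [hadamard, hxf, hff, hxy]
      simp [e1, e2, hxy]

theorem tMatrix_mem (q : Q) : tMatrix q ∈ Matrix.unitaryGroup (Q → Bool) ℂ := by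
  rw [Matrix.mem_unitaryGroup_iff', Matrix.star_eq_conjTranspose, tMatrix,
    Matrix.diagonal_conjTranspose, Matrix.diagonal_mul_diagonal, ← Matrix.diagonal_one]
  congr 1
  funext x
  cases hx : x q
  · simp [hx]
  · simp only [Pi.star_apply, hx, if_true, RCLike.star_def, ← Complex.exp_conj, ← Complex.exp_add,
      map_mul, Complex.conj_I, Complex.conj_ofReal]
    simp

theorem cnotMatrix_mem {c d : Q} (h : c ≠ d) :
    cnotMatrix c d ∈ Matrix.unitaryGroup (Q → Bool) ℂ := by
  have hinv : ∀ x, cnotMap c d (cnotMap c d x) = x := by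
    intro x
    cases hx : x c
    · simp [cnotMap, hx]
    · have : flipBit d x c = true := by simp [flipBit, h, hx]
      simp [cnotMap, hx, this, flipBit_flipBit]
  have hinj : Function.Injective (cnotMap c d) := Function.LeftInverse.injective hinv
  rw [Matrix.mem_unitaryGroup_iff', Matrix.star_eq_conjTranspose]
  ext a b
  simp [cnotMatrix, Matrix.mul_apply, Matrix.one_apply, hinj.eq_iff, eq_comm]

/-- The unitary of a gate. A `CNOT` whose control and target coincide acts as the identity. -/
def Gate.unitary : Gate Q → Matrix.unitaryGroup (Q → Bool) ℂ
  | .h q => ⟨hadamard q, hadamard_mem q⟩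
  | .t q => ⟨tMatrix q, tMatrix_mem q⟩
  | .cnot c d => if h : c ≠ d then ⟨cnotMatrix c d, cnotMatrix_mem h⟩ else 1

end Semantics

/-- The registers that a circuit of a machine works on: its private memory, the message that it
has just received, and the message that it is about to send. -/
inductive Reg where
  | work
  | inp
  | out

/-- A qubit address: a register and the number of a qubit in it. -/
abbrev Addr : Type := Reg × ℕ

/-- A circuit description: the list of its gates, the first to be applied first. -/
abbrev Circuit : Type := List (Gate Addr)

/-- Look an address up in registers of `w`, `m` and `n` qubits. -/
def resolve (w m n : ℕ) : Addr → Option (Fin w ⊕ (Fin m ⊕ Fin n))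
  | (.work, j) => if h : j < w then some (.inl ⟨j, h⟩) else none
  | (.inp, j) => if h : j < m then some (.inr (.inl ⟨j, h⟩)) else none
  | (.out, j) => if h : j < n then some (.inr (.inr ⟨j, h⟩)) else none

/-- Look the addresses of a gate up; `none` if one of them does not exist. -/
def resolveGate (w m n : ℕ) : Gate Addr → Option (Gate (Fin w ⊕ (Fin m ⊕ Fin n)))
  | .h q => (resolve w m n q).map .h
  | .t q => (resolve w m n q).map .t
  | .cnot c d => (resolve w m n c).bind fun c' => (resolve w m n d).map fun d' => .cnot c' d'

/-- The unitary of a circuit on registers of `w`, `m` and `n` qubits. Gates with a nonexistent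
address are skipped. -/
def Circuit.unitary (C : Circuit) (w m n : ℕ) :
    Matrix.unitaryGroup (Fin w ⊕ (Fin m ⊕ Fin n) → Bool) ℂ :=
  (((C.filterMap (resolveGate w m n)).map Gate.unitary).reverse).prod

/-- Three registers seen as one register. -/
def joinRegs (w m n : ℕ) :
    (Word w × Word m) × Word n ≃ (Fin w ⊕ (Fin m ⊕ Fin n) → Bool) :=
  (Equiv.prodAssoc _ _ _).trans
    (((Equiv.refl (Word w)).prodCongr (Equiv.sumArrowEquivProdArrow _ _ _).symm).trans
      (Equiv.sumArrowEquivProdArrow _ _ _).symm)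

/-- One activation of a machine with `w` private qubits: it receives a message of `m` qubits,
appends `n` fresh qubits in state `|0⟩` for its answer, applies the circuit, gives away the answer,
and drops what is left of the received message (it keeps what it has moved to its private memory). -/
def activate (C : Circuit) (w m n : ℕ) : Channel (Word w × Word m) (Word w × Word n) :=
  (((Channel.ofInjective (fun x : Word w × Word m => joinRegs w m n (x, zeroWord n))
      (fun _ _ h => congrArg Prod.fst ((joinRegs w m n).injective h))).seq
    (Channel.ofUnitary (C.unitary w m n))).seq
    (Channel.ofEquiv ((joinRegs w m n).symm.trans
      (⟨fun x => ((x.1.1, x.2), x.1.2), fun x => ((x.1.1, x.2), x.1.2),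
        fun _ => rfl, fun _ => rfl⟩ :
        (Word w × Word m) × Word n ≃ (Word w × Word n) × Word m)))).seq
    Channel.discardRight

/-- The alphabet in which circuits are described. -/
inductive Sym where
  | h
  | t
  | cnot
  | reg (r : Reg)
  | bit (b : Bool)

/-- An address as a string: the register, then the number in binary. -/
def encodeAddr (a : Addr) : List Sym :=
  .reg a.1 :: (Computability.encodeNat a.2).map .bit

/-- A gate as a string: its name, then its addresses. -/
def encodeGate : Gate Addr → List Sym
  | .h q => .h :: encodeAddr q
  | .t q => .t :: encodeAddr q
  | .cnot c d => .cnot :: (encodeAddr c ++ encodeAddr d)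

/-- The classical description of a circuit. -/
def encodeCircuit (C : Circuit) : List Sym := C.flatMap encodeGate

/-- The string `1^η` followed by `1^i`, over a disjoint union of two alphabets. -/
def encodeStage : ℕ × ℕ → List (Bool ⊕ Bool) :=
  (Computability.encodingProd Computability.unaryEncodingNat
    Computability.unaryEncodingNat).encode

/-- The family of circuits is uniform: a deterministic Turing machine prints the description of
the circuit for the security parameter `η` and the `i`-th activation in time polynomial
in `η + i`. -/
def PolyTimeUniform (C : ℕ → ℕ → Circuit) : Prop :=
  Nonempty (Turing.TM2ComputableInPolyTime encodeStage encodeCircuit fun s => C s.1 s.2)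

/-- Machines have two kinds of activations; what they mean depends on the role of the machine. -/
inductive Port where
  | fst
  | snd

/-- An interactive polynomial-time quantum machine (a `BQP` machine): for each security
parameter a polynomial number of private qubits, which persist between activations, and a uniform
polynomial-time family of quantum circuits. -/
structure BQPMachine where
  work : ℕ → ℕ
  work_poly : ∃ P : Polynomial ℕ, ∀ η, work η ≤ P.eval η
  prog : Port → ℕ → ℕ → Circuit
  uniform : ∀ a, PolyTimeUniform (prog a)

/-! ## Real and ideal executions -/

/-- The message pattern that a protocol fixes: in each round `P₁` sends `send i` qubits and then
receives `recv i` qubits. -/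
structure Interface where
  rounds : ℕ
  send : ℕ → ℕ
  recv : ℕ → ℕ

/-- What a corrupted `P₁` talks to: everybody else in the execution. It is given the
classical input `y` of `P₂` in the form of a basis state of its memory, and processes one
message in each round. -/
structure World (I : Interface) (nY : ℕ) where
  Mem : Type
  [fin : Fintype Mem]
  [dec : DecidableEq Mem]
  init : Word nY → Mem
  step : ∀ i : ℕ, Channel (Word (I.send i) × Mem) (Word (I.recv i) × Mem)

attribute [instance] World.fin World.dec

/-- An ideal functionality as it is accessed by a corrupted `P₁`, with the honest `P₂`
giving it the input `y`. -/
structure Functionality (nY : ℕ) where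
  Mem : Type
  [fin : Fintype Mem]
  [dec : DecidableEq Mem]
  query : ℕ
  reply : ℕ
  init : Word nY → Mem
  step : Channel (Word query × Mem) (Word reply × Mem)

attribute [instance] Functionality.fin Functionality.dec

/-- The number of qubits that `P₁` has received just before it sends its `i`-th message. -/
def Interface.inbox (I : Interface) : ℕ → ℕ
  | 0 => 0
  | i + 1 => I.recv i

section Execution

variable {I : Interface} {nY : ℕ}

/-- The Environment prepares the input `y` of `P₂` (which is classical, that is, measured in the
computational basis) together with the initial memory of the Adversary, of `a` qubits. -/
def startState (Z : BQPMachine) (η a : ℕ) (W : World I nY) :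
    Matrix ((Word a × Word (I.inbox 0)) × W.Mem) ((Word a × Word (I.inbox 0)) × W.Mem) ℂ :=
  ((((activate (Z.prog .fst η 0) (Z.work η) 0 (nY + a)).seq
    (Channel.ofEquiv (Equiv.prodComm _ _))).seq Channel.discardRight).seq
    ((Channel.ofEquiv (Fin.appendEquiv nY a).symm).seq
      ((Channel.classical W.init).onLeft.seq
        (Channel.ofInjective (fun x : W.Mem × Word a => ((x.2, zeroWord (I.inbox 0)), x.1))
          (fun _ _ h => Prod.ext (congrArg (fun z => z.2) h)
            (congrArg (fun z => z.1.1) h)))))).apply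
    (Matrix.single (zeroWord _, zeroWord _) (zeroWord _, zeroWord _) 1)

/-- The joint state of the Adversary (memory and last received message) and the rest of the world
after `i` rounds. In each round the Adversary is activated on its port `fst` and its
message is processed by the rest of the world. -/
def stateAfter (A Z : BQPMachine) (η : ℕ) (W : World I nY) : (i : ℕ) →
    Matrix ((Word (A.work η) × Word (I.inbox i)) × W.Mem)
      ((Word (A.work η) × Word (I.inbox i)) × W.Mem) ℂ
  | 0 => startState Z η (A.work η) W
  | i + 1 =>
    (((activate (A.prog .fst η i) (A.work η) (I.inbox i) (I.send i)).onLeft.seq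
      (Channel.ofEquiv (Equiv.prodAssoc _ _ _))).seq
      ((W.step i).onRight.seq (Channel.ofEquiv (Equiv.prodAssoc _ _ _).symm))).apply
      (stateAfter A Z η W i)

/-- The probability that the Adversary outputs `0`. After the last round it is activated on its
port `snd` and the one qubit that it produces is measured. -/
def probZero (A Z : BQPMachine) (η : ℕ) (W : World I nY) : ℝ :=
  let ρ := (activate (A.prog .snd η 0) (A.work η) (I.inbox I.rounds) 1).onLeft.apply
    (stateAfter A Z η W I.rounds)
  ∑ x, if x.1.2 0 = false then (ρ x x).re else 0

/-- The ideal world: in each round the Simulator is activated on its port `fst` by the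
Adversary's message, passes a query register to the functionality, is activated on its port
`snd` by the reply, and answers the Adversary. It never sees `y`. -/
def idealWorld (S : BQPMachine) (η : ℕ) (F : Functionality nY) : World I nY where
  Mem := Word (S.work η) × F.Mem
  init y := (zeroWord _, F.init y)
  step i :=
    ((Channel.ofEquiv
        (⟨fun x => ((x.2.1, x.1), x.2.2), fun x => (x.1.2, (x.1.1, x.2)),
          fun _ => rfl, fun _ => rfl⟩ :
          Word (I.send i) × (Word (S.work η) × F.Mem) ≃
            (Word (S.work η) × Word (I.send i)) × F.Mem)).seq
      ((activate (S.prog .fst η i) (S.work η) (I.send i) F.query).onLeft.seq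
        (Channel.ofEquiv (Equiv.prodAssoc _ _ _)))).seq
      ((F.step.onRight.seq (Channel.ofEquiv (Equiv.prodAssoc _ _ _).symm)).seq
        ((activate (S.prog .snd η i) (S.work η) F.reply (I.recv i)).onLeft.seq
          (Channel.ofEquiv
            (⟨fun x => (x.1.2, (x.1.1, x.2)), fun x => ((x.2.1, x.1), x.2.2),
              fun _ => rfl, fun _ => rfl⟩ :
              (Word (S.work η) × Word (I.recv i)) × F.Mem ≃
                Word (I.recv i) × (Word (S.work η) × F.Mem)))))

end Execution

/-- The protocol whose honest side is `real` `ε`-securely emulates the functionality `F` against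
a `BQP`-adversarial `P₁`. -/
def SecurelyEmulates {nY : ℕ → ℕ} {I : ℕ → Interface} (real : ∀ η, World (I η) (nY η))
    (F : ∀ η, Functionality (nY η)) (ε : ℕ → ℝ) : Prop :=
  Filter.Tendsto ε Filter.atTop (nhds 0) ∧
  ∀ A Z : BQPMachine, ∃ S : BQPMachine, ∀ η,
    |probZero A Z η (idealWorld S η (F η) : World (I η) (nY η)) - probZero A Z η (real η)| ≤ ε η

/-! ## The two-party computation functionality with output to `P₂` only -/

/-- The memory of the functionality: the input of `P₂` and what it has sent to `P₂`
(`none`: nothing yet; `some none`: `Abort`; `some (some z)`: the output `z`). -/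
abbrev SfeMem (nY : ℕ) : Type := Word nY × Option (Option Bool)

/-- The answer to a query. Query: bit `0` says that the functionality is called, bit `1` that
`Abort` (or an ill-formatted input) is sent, the others are the input `x`. Reply: bit `0` says that
there is one, bit `1` that it is `Abort`, the others repeat the measured `x`. Only the first
call is answered. -/
def sfeMap {nX nY : ℕ} (f : Word nX → Word nY → Bool) :
    Word (2 + nX) × SfeMem nY → Word (2 + nX) × SfeMem nY := fun s =>
  let called := s.1 (Fin.castAdd nX 0)
  let abort := s.1 (Fin.castAdd nX 1)
  let x : Word nX := fun j => s.1 (Fin.natAdd 2 j)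
  if called = true ∧ s.2.2 = none then
    if abort then (Fin.append ![true, true] (zeroWord nX), (s.2.1, some none))
    else (Fin.append ![true, false] x, (s.2.1, some (some (f x s.2.1))))
  else (zeroWord _, s.2)

/-- Secure function evaluation of `f`: the inputs are measured in the computational basis, `P₂`
gets `f x y`, and `P₁` gets nothing but its measured input. -/
def sfe {nX nY : ℕ} (f : Word nX → Word nY → Bool) : Functionality nY where
  Mem := SfeMem nY
  query := 2 + nX
  reply := 2 + nX
  init y := (y, none)
  step := Channel.classical (sfeMap f)

/-! ## The protocol -/

/-- A symmetric encryption scheme with keys, auxiliary values and messages of `nK`, `nA` and `nM`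
bits. Decryption is done in place: `|k⟩|a⟩|c⟩ ↦ |dK k⟩|dA a⟩|dec k a c⟩`, with permutations
`dK`, `dA` of the keys and of the auxiliary values. -/
structure EncScheme (nK nA nM : ℕ) where
  enc : Word nK → Word nA → Word nM → Word nM
  dec : Word nK → Word nA → Word nM → Word nM
  dec_enc : ∀ k a m, dec k a (enc k a m) = m
  dK : Equiv.Perm (Word nK)
  dA : Equiv.Perm (Word nA)

theorem EncScheme.dec_injective {nK nA nM : ℕ} (E : EncScheme nK nA nM) (k : Word nK)
    (a : Word nA) : Function.Injective (E.dec k a) :=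
  Finite.injective_iff_surjective.2 fun m => ⟨E.enc k a m, E.dec_enc k a m⟩

section Protocol

variable (nX nY nK nA p : ℕ)

/-- The input wires: those of the Garbler, then those of the Evaluator. -/
abbrev Wire : Type := Fin nX ⊕ Fin nY

/-- The entries of the garbled table. -/
abbrev Entry : Type := Fin (2 ^ (nX + nY))

/-- The final message of the Garbler: the garbled table, the keys for its own input, and the
auxiliary values used for the encryption. -/
abbrev GarblerMsg : Type :=
  (Entry nX nY → Word (p + 1)) × (Fin nX → Word nK) × (Wire nX nY → Word nA)

/-- The length of that message in qubits. -/
def msgLen : ℕ := 2 ^ (nX + nY) * (p + 1) + (nX * nK + (nX + nY) * nA)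

/-- The layout of that message as a string of qubits: its parts one after the other. -/
def unpack : Word (msgLen nX nY nK nA p) ≃ GarblerMsg nX nY nK nA p :=
  (Fin.appendEquiv _ _).symm.trans
    (((finProdFinEquiv.arrowCongr (Equiv.refl Bool)).symm.trans (Equiv.curry _ _ _)).prodCongr
      ((Fin.appendEquiv _ _).symm.trans
        (((finProdFinEquiv.arrowCongr (Equiv.refl Bool)).symm.trans (Equiv.curry _ _ _)).prodCongr
          (((finProdFinEquiv.arrowCongr (Equiv.refl Bool)).symm.trans (Equiv.curry _ _ _)).trans
            (finSumFinEquiv.arrowCongr (Equiv.refl _)).symm))))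

/-- The registers of the Evaluator. Its output is the first bit of the entry `out` of the table,
respectively `Abort` if `out` is `none`. -/
@[ext] structure EvalMem where
  /-- its input -/
  y : Word nY
  /-- for each of its wires, whether the oblivious transfer has delivered a key -/
  got : Fin nY → Bool
  /-- the delivered keys -/
  keys : Fin nY → Word nK
  /-- the garbled table, overwritten during decryption -/
  table : Entry nX nY → Word (p + 1)
  /-- the keys of the Garbler -/
  gKeys : Fin nX → Word nK
  /-- the auxiliary values -/
  aux : Wire nX nY → Word nA
  /-- the entry that was decrypted successfully -/
  out : Option (Entry nX nY)

/-- The registers of the Evaluator as a tuple. -/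
def evalMemEquiv : EvalMem nX nY nK nA p ≃
    ((Word nY × (Fin nY → Bool)) × (Fin nY → Word nK)) ×
      (GarblerMsg nX nY nK nA p × Option (Entry nX nY)) where
  toFun m := (((m.y, m.got), m.keys), ((m.table, m.gKeys, m.aux), m.out))
  invFun t := ⟨t.1.1.1, t.1.1.2, t.1.2, t.2.1.1, t.2.1.2.1, t.2.1.2.2, t.2.2⟩
  left_inv _ := rfl
  right_inv _ := rfl

set_option synthInstance.maxSize 1000 in
instance : DecidableEq (EvalMem nX nY nK nA p) := (evalMemEquiv nX nY nK nA p).decidableEq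

set_option synthInstance.maxSize 1000 in
instance : Fintype (EvalMem nX nY nK nA p) := Fintype.ofEquiv _ (evalMemEquiv nX nY nK nA p).symm

/-- There are `nY` oblivious transfers, in which the Garbler sends an abort flag and two keys and
receives one bit (`Abort` or not), and then the message of the Garbler, to which
there is no reply. -/
def yaoInterface : Interface where
  rounds := nY + 1
  send i := if i < nY then 1 + (nK + nK) else msgLen nX nY nK nA p
  recv i := if i < nY then 1 else 0

variable {nX nY nK nA p}

/-- The `i`-th oblivious transfer, by a classical trusted party: everything is measured in the
computational basis. The Garbler's string is an abort flag followed by `k₀` and `k₁`. On `Abort`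
both parties are told so; otherwise the Evaluator receives `k₀` or `k₁` according to
its choice bit `y i`, and the Garbler nothing. -/
def otMap {n r : ℕ} (hn : n = 1 + (nK + nK)) (i : Fin nY) :
    Word n × EvalMem nX nY nK nA p → Word r × EvalMem nX nY nK nA p := fun s =>
  let abort := s.1 (Fin.cast hn.symm (Fin.castAdd _ 0))
  let k₀ : Word nK := fun j => s.1 (Fin.cast hn.symm (Fin.natAdd 1 (Fin.castAdd nK j)))
  let k₁ : Word nK := fun j => s.1 (Fin.cast hn.symm (Fin.natAdd 1 (Fin.natAdd nK j)))
  let m := s.2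
  if abort then (fun _ => true, m)
  else (fun _ => false, { m with
    got := Function.update m.got i true
    keys := Function.update m.keys i (if m.y i then k₁ else k₀) })

variable (E : EncScheme nK nA (p + 1))

/-- In-place decryption of entry `e` of the table with the key and auxiliary value of one wire. -/
def decWire (e : Entry nX nY) (w : Wire nX nY) (m : EvalMem nX nY nK nA p) :
    EvalMem nX nY nK nA p :=
  match w with
  | .inl i => { m with
      table := Function.update m.table e (E.dec (m.gKeys i) (m.aux (.inl i)) (m.table e))
      gKeys := Function.update m.gKeys i (E.dK (m.gKeys i))
      aux := Function.update m.aux (.inl i) (E.dA (m.aux (.inl i))) }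
  | .inr i => { m with
      table := Function.update m.table e (E.dec (m.keys i) (m.aux (.inr i)) (m.table e))
      keys := Function.update m.keys i (E.dK (m.keys i))
      aux := Function.update m.aux (.inr i) (E.dA (m.aux (.inr i))) }

theorem update_apply_inj {α β : Type} [DecidableEq α] {i : α} {g g' : α → β} {π : β → β}
    (hπ : Function.Injective π)
    (h : Function.update g i (π (g i)) = Function.update g' i (π (g' i))) : g = g' := by
  funext j
  have hj := congrFun h j
  by_cases hji : j = i
  · subst hji
    simpa [hπ.eq_iff] using hj
  · simpa [hji] using hj

theorem decWire_injective (e : Entry nX nY) (w : Wire nX nY) :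
    Function.Injective (decWire E e w : EvalMem nX nY nK nA p → EvalMem nX nY nK nA p) := by
  rintro ⟨y, got, keys, table, gKeys, aux, out⟩ ⟨y', got', keys', table', gKeys', aux', out'⟩ h
  cases w with
  | inl i =>
    simp only [decWire, EvalMem.mk.injEq] at h
    obtain ⟨rfl, rfl, rfl, ht, hg, ha, rfl⟩ := h
    obtain rfl := update_apply_inj E.dK.injective hg
    obtain rfl := update_apply_inj E.dA.injective ha
    obtain rfl := update_apply_inj (E.dec_injective _ _) ht
    rfl
  | inr i =>
    simp only [decWire, EvalMem.mk.injEq] at h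
    obtain ⟨rfl, rfl, hg, ht, rfl, ha, rfl⟩ := h
    obtain rfl := update_apply_inj E.dK.injective hg
    obtain rfl := update_apply_inj E.dA.injective ha
    obtain rfl := update_apply_inj (E.dec_injective _ _) ht
    rfl

/-- The inverses of `dK` and `dA` on all keys and auxiliary values. -/
def undoKeys (m : EvalMem nX nY nK nA p) : EvalMem nX nY nK nA p :=
  { m with
    keys := fun i => E.dK.symm (m.keys i)
    gKeys := fun i => E.dK.symm (m.gKeys i)
    aux := fun w => E.dA.symm (m.aux w) }

theorem undoKeys_injective :
    Function.Injective (undoKeys E : EvalMem nX nY nK nA p → EvalMem nX nY nK nA p) := by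
  rintro ⟨y, got, keys, table, gKeys, aux, out⟩ ⟨y', got', keys', table', gKeys', aux', out'⟩ h
  simp only [undoKeys, EvalMem.mk.injEq, funext_iff, EmbeddingLike.apply_eq_iff_eq] at h
  simp only [EvalMem.mk.injEq, funext_iff]
  exact h

/-- Record the entry `e` as the outcome, in an outcome register that holds `none`. -/
def setOutcome (e : Entry nX nY) (m : EvalMem nX nY nK nA p) : EvalMem nX nY nK nA p :=
  { m with out := Equiv.swap none (some e) m.out }

theorem setOutcome_injective (e : Entry nX nY) :
    Function.Injective (setOutcome e : EvalMem nX nY nK nA p → EvalMem nX nY nK nA p) := by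
  rintro ⟨y, got, keys, table, gKeys, aux, out⟩ ⟨y', got', keys', table', gKeys', aux', out'⟩ h
  simpa [setOutcome] using h

/-- The wires in the order in which an entry is decrypted: an entry is encrypted with the keys of
the Evaluator and then those of the Garbler. -/
def wireOrder (nX nY : ℕ) : List (Wire nX nY) :=
  (List.finRange nX).reverse.map .inl ++ (List.finRange nY).reverse.map .inr

/-- In-place decryption of entry `e` with all keys. -/
def decryptEntry (e : Entry nX nY) : Channel (EvalMem nX nY nK nA p) (EvalMem nX nY nK nA p) :=
  (wireOrder nX nY).foldr
    (fun w Φ => (Channel.ofInjective (decWire E e w) (decWire_injective E e w)).seq Φ)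
    (Channel.ofEquiv (Equiv.refl _))

/-- The last `p` bits of entry `e` are zero. -/
def padIsZero (e : Entry nX nY) (m : EvalMem nX nY nK nA p) : Bool :=
  decide (∀ j : Fin p, m.table e j.succ = false)

/-- Decrypt the listed entries one after the other and measure after each whether the padding is
`0^p`: if so, stop with this outcome; if not, restore the keys and auxiliary values and
proceed to the next entry. If no entry is left, the outcome remains `none` (`Abort`). -/
def evaluate : List (Entry nX nY) → Channel (EvalMem nX nY nK nA p) (EvalMem nX nY nK nA p)
  | [] => Channel.ofEquiv (Equiv.refl _)
  | e :: es => (decryptEntry E e).seq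
      (Channel.measureThen (padIsZero e)
        (Channel.ofInjective (setOutcome e) (setOutcome_injective e))
        ((Channel.ofInjective (undoKeys E) (undoKeys_injective E)).seq (evaluate es)))

/-- Move the received message into the (so far empty) message registers of the Evaluator. -/
def load {n : ℕ} (hn : n = msgLen nX nY nK nA p) :
    Word n × EvalMem nX nY nK nA p ≃ EvalMem nX nY nK nA p × Word n :=
  let u : Word n ≃ GarblerMsg nX nY nK nA p :=
    ((finCongr hn).arrowCongr (Equiv.refl Bool)).trans (unpack nX nY nK nA p)
  { toFun := fun s =>
      ({ s.2 with table := (u s.1).1, gKeys := (u s.1).2.1, aux := (u s.1).2.2 },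
        u.symm (s.2.table, s.2.gKeys, s.2.aux))
    invFun := fun s =>
      (u.symm (s.1.table, s.1.gKeys, s.1.aux),
        { s.1 with table := (u s.2).1, gKeys := (u s.2).2.1, aux := (u s.2).2.2 })
    left_inv := fun s => by simp
    right_inv := fun s => by simp }

/-- The Evaluator on the message of the Garbler. If an oblivious transfer has not delivered a key it
does nothing (so that its output is `Abort`), otherwise it evaluates the table. The
message that goes back to the Garbler is independent of everything (and of length `r = 0`). -/
def finalStep {n r : ℕ} (hn : n = msgLen nX nY nK nA p) :
    Channel (Word n × EvalMem nX nY nK nA p) (Word r × EvalMem nX nY nK nA p) :=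
  (((Channel.ofEquiv (load hn)).seq Channel.discardRight).seq
    (Channel.measureThen (fun m => decide (∀ i, m.got i = true))
      (evaluate E (List.finRange _)) (Channel.ofEquiv (Equiv.refl _)))).seq
    (Channel.ofInjective (fun m => (zeroWord r, m)) (fun _ _ h => congrArg Prod.snd h))

/-- The honest side of the superposition-resistant Yao protocol in the OT-hybrid model: the
Evaluator together with the trusted party for oblivious transfer. -/
def yaoEvaluator : World (yaoInterface nX nY nK nA p) nY where
  Mem := EvalMem nX nY nK nA p
  init y :=
    { y := y, got := fun _ => false, keys := fun _ => zeroWord nK, table := fun _ => zeroWord _,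
      gKeys := fun _ => zeroWord nK, aux := fun _ => zeroWord nA, out := none }
  step i :=
    if h : i < nY then Channel.classical (otMap (if_pos h) ⟨i, h⟩)
    else finalStep E (if_neg h)

end Protocol

end SupYao

end

/-!
The Evaluator never tells the Garbler anything after the oblivious transfers, and in an oblivious
transfer the trusted party tells the Garbler only whether it has sent `Abort`, a bit that the
Garbler has itself supplied and that has been measured. So the whole of the honest side is, from
the point of view of the Garbler, the measurement of the abort flag in each oblivious transfer,
and this does not depend on the input `y`, on the function `f` or on the encryption scheme.

In the model, the honest side of an execution is a channel on the message and its own memory. Such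
a world answers a message by a map `T` (`World.Answers`) if tracing out the memory after the step
gives `T` of the message, for every joint matrix of message and memory. Since this is required
for arbitrary matrices, it survives entanglement of the message with the Adversary, and an
induction over the rounds shows that two worlds that answer by the same maps leave the Adversary in
the same reduced state (`partialTrace_stateAfter`); the output bit is a function of
this state (`probZero_eq`).

In an oblivious transfer, `T` measures the abort flag and returns it (`yaoEvaluator_answers`). In
the last round the answer is empty, and `T` is the trace because channels preserve it
(`World.answers_of_recv_eq_zero`), whatever is done in superposition with the garbled table.

The Simulator `flagSimulator` is a machine with one private qubit and constant circuits. It moves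
the abort flag of each message to its private qubit and answers with a `CNOT` copy of it.
Keeping the original is what measures the answer, as in the oblivious transfer. It also
passes an `Abort` of the Adversary on to the functionality, one round later so that the first
qubit of the garbled table, which is not an abort flag, never causes a query; as it
uses nothing of the reply, and a channel applied to the query leaves the reduced state of the rest
unchanged, this has no influence on its answers (`Channel.partialTrace_relay_apply`,
`flagSimulator_answers`). Security is only about the output bit of the Adversary, so nothing has to
be extracted from the garbled table. The circuits of the Simulator are uniform because a
Turing machine that empties its input stack and prints a fixed list runs in linear time
(`polyTimeUniform_const`).
-/

noncomputable section

namespace SupYao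

/-! ### Partial traces of channel outputs -/

/-- The reduced state of the left subsystem. -/
def partialTrace {X R : Type} [Fintype R] (ρ : Matrix (X × R) (X × R) ℂ) : Matrix X X ℂ :=
  Matrix.of fun a b => ∑ r, ρ (a, r) (b, r)

/-- The operator `|x⟩ ↦ |g x⟩` of a map `g` of basis states. -/
def basisMatrix {X Y : Type} [DecidableEq Y] (g : X → Y) : Matrix Y X ℂ :=
  Matrix.of fun y x => if y = g x then 1 else 0

theorem basisMatrix_mul {X Y Z : Type} [Fintype Y] [DecidableEq Y] [DecidableEq Z]
    (g : Y → Z) (h : X → Y) : basisMatrix g * basisMatrix h = basisMatrix (g ∘ h) := by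
  ext z x
  simp [basisMatrix, Matrix.mul_apply]

theorem basisMatrix_conj_apply {X Y : Type} [Fintype X] [DecidableEq Y] (g : X → Y)
    (ρ : Matrix X X ℂ) (y y' : Y) :
    (basisMatrix g * ρ * (basisMatrix g).conjTranspose) y y'
      = ∑ x, ∑ x', if y = g x ∧ y' = g x' then ρ x x' else 0 := by
  simp only [basisMatrix, Matrix.mul_apply, Matrix.conjTranspose_apply, Matrix.of_apply,
    Finset.sum_mul]
  rw [Finset.sum_comm]
  refine Finset.sum_congr rfl fun x _ => Finset.sum_congr rfl fun x' _ => ?_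
  by_cases h : y = g x <;> by_cases h' : y' = g x' <;> simp [h, h']

theorem trace_partialTrace {X R : Type} [Fintype X] [Fintype R] (ρ : Matrix (X × R) (X × R) ℂ) :
    (partialTrace ρ).trace = ρ.trace := by
  simp [Matrix.trace, partialTrace, Fintype.sum_prod_type]

namespace Channel

variable {X Y Z R : Type} [Fintype X] [DecidableEq X] [Fintype Y] [Fintype Z] [Fintype R]

theorem seq_apply [DecidableEq Y] (Φ : Channel X Y) (Ψ : Channel Y Z) (ρ : Matrix X X ℂ) :
    (Φ.seq Ψ).apply ρ = Ψ.apply (Φ.apply ρ) := by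
  change (∑ ij : Φ.ι × Ψ.ι, Ψ.kraus ij.2 * Φ.kraus ij.1 * ρ *
    (Ψ.kraus ij.2 * Φ.kraus ij.1).conjTranspose) = _
  simp only [apply, Fintype.sum_prod_type, Matrix.mul_sum, Matrix.sum_mul,
    Matrix.conjTranspose_mul, Matrix.mul_assoc]
  exact Finset.sum_comm

theorem trace_apply (Φ : Channel X Y) (ρ : Matrix X X ℂ) : (Φ.apply ρ).trace = ρ.trace := by
  have h : ∀ i, (Φ.kraus i * ρ * (Φ.kraus i).conjTranspose).trace
      = ((Φ.kraus i).conjTranspose * Φ.kraus i * ρ).trace := fun i => by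
    rw [Matrix.mul_assoc, Matrix.trace_mul_comm, Matrix.mul_assoc, Matrix.trace_mul_comm]
  rw [apply, Matrix.trace_sum]
  simp only [h]
  rw [← Matrix.trace_sum, ← Matrix.sum_mul, Φ.tp, Matrix.one_mul]

theorem ofUnitary_apply (U : Matrix.unitaryGroup X ℂ) (ρ : Matrix X X ℂ) :
    (ofUnitary U).apply ρ = U.1 * ρ * U.1.conjTranspose :=
  Finset.sum_eq_single_of_mem () (Finset.mem_univ _) fun _ _ h => (h rfl).elim

theorem ofInjective_apply [DecidableEq Y] (g : X → Y) (hg : Function.Injective g)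
    (ρ : Matrix X X ℂ) :
    (ofInjective g hg).apply ρ = basisMatrix g * ρ * (basisMatrix g).conjTranspose :=
  Finset.sum_eq_single_of_mem () (Finset.mem_univ _) fun _ _ h => (h rfl).elim

theorem ofInjective_apply_apply [DecidableEq Y] (g : X → Y) (hg : Function.Injective g)
    (ρ : Matrix X X ℂ) (x x' : X) : (ofInjective g hg).apply ρ (g x) (g x') = ρ x x' := by
  rw [ofInjective_apply, basisMatrix_conj_apply]
  simp [hg.eq_iff, ite_and]

theorem ofEquiv_apply [DecidableEq Y] (g : X ≃ Y) (ρ : Matrix X X ℂ) :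
    (ofEquiv g).apply ρ = ρ.submatrix g.symm g.symm := by
  ext y y'
  obtain ⟨x, rfl⟩ := g.surjective y
  obtain ⟨x', rfl⟩ := g.surjective y'
  simp [ofEquiv, ofInjective_apply_apply]

theorem classical_apply [DecidableEq Y] (g : X → Y) (ρ : Matrix X X ℂ) (y y' : Y) :
    (classical g).apply ρ y y' = ∑ x, if y = g x ∧ y' = g x then ρ x x else 0 := by
  change (∑ x, Matrix.single (g x) x (1 : ℂ) * ρ *
    (Matrix.single (g x) x (1 : ℂ)).conjTranspose : Matrix Y Y ℂ) y y' = _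
  rw [Matrix.sum_apply]
  refine Finset.sum_congr rfl fun x _ => ?_
  by_cases h : y = g x <;> by_cases h' : y' = g x <;>
    simp [h, h', Matrix.mul_apply, Matrix.single_apply, eq_comm]

theorem discardRight_apply [DecidableEq R] (ρ : Matrix (X × R) (X × R) ℂ) :
    discardRight.apply ρ = partialTrace ρ := by
  ext a b
  change (∑ r : R, (Matrix.of fun (x : X) (z : X × R) => if z = (x, r) then (1 : ℂ) else 0) * ρ *
    (Matrix.of fun (x : X) (z : X × R) => if z = (x, r) then (1 : ℂ) else 0).conjTranspose :
      Matrix X X ℂ) a b = _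
  simp [Matrix.sum_apply, Matrix.mul_apply, partialTrace]

/-- `Φ ⊗ id` acts on each block of a matrix separately. -/
theorem onLeft_apply [DecidableEq R] (Φ : Channel X Y) (ρ : Matrix (X × R) (X × R) ℂ)
    (y y' : Y) (r r' : R) :
    Φ.onLeft.apply ρ (y, r) (y', r')
      = Φ.apply (Matrix.of fun x x' => ρ (x, r) (x', r')) y y' := by
  change (∑ i, (Φ.kraus i ⊗ₖ (1 : Matrix R R ℂ)) * ρ *
    (Φ.kraus i ⊗ₖ (1 : Matrix R R ℂ)).conjTranspose) (y, r) (y', r') = _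
  rw [apply, Matrix.sum_apply, Matrix.sum_apply]
  refine Finset.sum_congr rfl fun i _ => ?_
  simp [Matrix.mul_apply, Fintype.sum_prod_type, Matrix.one_apply, apply_ite (starRingEnd ℂ)]

/-- `id ⊗ Φ` acts on each block of a matrix separately. -/
theorem onRight_apply [DecidableEq Y] [DecidableEq R] (Φ : Channel X Y)
    (ρ : Matrix (R × X) (R × X) ℂ) (r r' : R) (y y' : Y) :
    Φ.onRight.apply ρ (r, y) (r', y')
      = Φ.apply (Matrix.of fun x x' => ρ (r, x) (r', x')) y y' := by
  rw [onRight, seq_apply, seq_apply, ofEquiv_apply, ofEquiv_apply]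
  exact onLeft_apply ..

theorem partialTrace_onLeft_apply [DecidableEq R] (Φ : Channel X Y) (ρ : Matrix (X × R) (X × R) ℂ) :
    partialTrace (Φ.onLeft.apply ρ) = Φ.apply (partialTrace ρ) := by
  have h : partialTrace ρ = ∑ r, Matrix.of fun x x' => ρ (x, r) (x', r) := by
    ext a b
    simp [partialTrace, Matrix.sum_apply]
  ext y y'
  simp only [partialTrace, Matrix.of_apply, onLeft_apply] at h ⊢
  rw [h]
  simp only [apply, Matrix.mul_sum, Matrix.sum_mul]
  rw [Finset.sum_comm, Matrix.sum_apply]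

/-- A channel on the discarded subsystem does not affect the reduced state. -/
theorem partialTrace_onRight_apply [DecidableEq Y] [DecidableEq R] (Φ : Channel X Y)
    (ρ : Matrix (R × X) (R × X) ℂ) :
    partialTrace (Φ.onRight.apply ρ) = partialTrace ρ := by
  ext r r'
  simp only [partialTrace, Matrix.of_apply, onRight_apply]
  exact Φ.trace_apply _

/-- If the first component of the value of a classical map depends only on that of its
argument, then the reduced state is processed by a classical map, too. -/
theorem partialTrace_classical_apply [DecidableEq Y] [DecidableEq R] [DecidableEq Z]
    {g : X × R → Y × Z} {h : X → Y} (hg : ∀ s, (g s).1 = h s.1)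
    (ρ : Matrix (X × R) (X × R) ℂ) :
    partialTrace ((classical g).apply ρ) = (classical h).apply (partialTrace ρ) := by
  ext y y'
  simp only [partialTrace, Matrix.of_apply, classical_apply]
  rw [Finset.sum_comm, Fintype.sum_prod_type]
  refine Finset.sum_congr rfl fun x _ => ?_
  have e : ∀ r, (∑ z, if (y, z) = g (x, r) ∧ (y', z) = g (x, r) then ρ (x, r) (x, r) else 0)
      = if y = h x ∧ y' = h x then ρ (x, r) (x, r) else 0 := by
    intro r
    rw [Finset.sum_eq_single (g (x, r)).2]
    · simp [Prod.ext_iff, hg]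
    · rintro z - hz
      exact if_neg fun hz' => hz (congrArg Prod.snd hz'.1)
    · simp
  simp only [e]
  split_ifs <;> simp

end Channel

/-! ### Worlds with the same answers are indistinguishable -/

section Indistinguishable

variable {I : Interface} {nY : ℕ}

/-- The answer of the world `W` in round `i` depends only on the message of that round: it is
obtained by the map `T`, whatever the memory of `W` is entangled with. The matrices
`σ` are arbitrary, so that `T` also describes what happens when the message is entangled with
the memory of the sender. -/
def World.Answers (W : World I nY) (i : ℕ)
    (T : Matrix (Word (I.send i)) (Word (I.send i)) ℂ →
      Matrix (Word (I.recv i)) (Word (I.recv i)) ℂ) : Prop :=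
  ∀ σ, partialTrace ((W.step i).apply σ) = T (partialTrace σ)

/-- A world only copies the measured input `y` into its own memory, which does not change the
initial state of the Adversary. -/
theorem partialTrace_startState (Z : BQPMachine) (η a : ℕ) (W W' : World I nY) :
    partialTrace (startState Z η a W) = partialTrace (startState Z η a W') := by
  suffices h : ∃ τ : Matrix (Word nY × Word a) (Word nY × Word a) ℂ, ∀ W : World I nY,
      partialTrace (startState Z η a W)
        = Matrix.of fun x x' => ∑ y, τ (y, x.1) (y, x'.1) by
    obtain ⟨τ, h⟩ := h
    rw [h, h]
  refine ⟨(Channel.ofEquiv (Fin.appendEquiv nY a).symm).apply (Channel.discardRight.apply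
    ((Channel.ofEquiv (Equiv.prodComm _ _)).apply
      ((activate (Z.prog .fst η 0) (Z.work η) 0 (nY + a)).apply
        (Matrix.single (zeroWord _, zeroWord _) (zeroWord _, zeroWord _) 1)))), fun W => ?_⟩
  ext ⟨b, u⟩ ⟨b', u'⟩
  -- The inbox of round `0` has no qubits.
  have e : ∀ v : Word (I.inbox 0), v = zeroWord _ := fun v => funext fun j => j.elim0
  rw [e u, e u', startState]
  simp only [Channel.seq_apply, partialTrace, Matrix.of_apply]
  have h := fun (ρ : Matrix (W.Mem × Word a) (W.Mem × Word a) ℂ) (m : W.Mem) =>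
    Channel.ofInjective_apply_apply
      (fun x : W.Mem × Word a => ((x.2, zeroWord (I.inbox 0)), x.1))
      (fun _ _ h => Prod.ext (congrArg (fun z => z.2) h) (congrArg (fun z => z.1.1) h))
      ρ (m, b) (m, b')
  simp only at h
  simp only [h, Channel.onLeft_apply]
  exact Channel.trace_apply ..

/-- As long as two worlds answer in the same way, the reduced states of the Adversary
agree. -/
theorem partialTrace_stateAfter (A Z : BQPMachine) (η : ℕ) (W W' : World I nY) (n : ℕ)
    (h : ∀ i < n, ∃ T, W.Answers i T ∧ W'.Answers i T) :
    partialTrace (stateAfter A Z η W n) = partialTrace (stateAfter A Z η W' n) := by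
  induction n with
  | zero => exact partialTrace_startState ..
  | succ n ih =>
    have ih := ih fun i hi => h i (by omega)
    obtain ⟨T, hT, hT'⟩ := h n (by omega)
    suffices key : ∀ V : World I nY, V.Answers n T →
        partialTrace (stateAfter A Z η V (n + 1)) = Matrix.of fun x x' =>
          T (Matrix.of fun s s' => (activate (A.prog .fst η n) (A.work η) (I.inbox n)
            (I.send n)).apply (partialTrace (stateAfter A Z η V n)) (x.1, s) (x'.1, s')) x.2 x'.2 by
      rw [key W hT, key W' hT', ih]
    intro V hV
    ext ⟨b, r⟩ ⟨b', r'⟩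
    rw [stateAfter, Channel.seq_apply, Channel.seq_apply, Channel.seq_apply,
      Channel.ofEquiv_apply, Channel.ofEquiv_apply]
    refine (Finset.sum_congr rfl fun m _ => Channel.onRight_apply (V.step n) _ b b' (r, m)
      (r', m)).trans ?_
    have h1 := congrFun (congrFun (hV (Matrix.of fun x x' =>
      (activate (A.prog .fst η n) (A.work η) (I.inbox n) (I.send n)).onLeft.apply
        (stateAfter A Z η V n) ((b, x.1), x.2) ((b', x'.1), x'.2))) r) r'
    refine Eq.trans h1 ?_
    congr 2
    ext s s'
    exact congrFun (congrFun (Channel.partialTrace_onLeft_apply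
      (activate (A.prog .fst η n) (A.work η) (I.inbox n) (I.send n))
      (stateAfter A Z η V n)) (b, s)) (b', s')

theorem probZero_eq (A Z : BQPMachine) (η : ℕ) (W W' : World I nY)
    (h : ∀ i < I.rounds, ∃ T, W.Answers i T ∧ W'.Answers i T) :
    probZero A Z η W = probZero A Z η W' := by
  have key : ∀ V : World I nY, probZero A Z η V
      = ∑ x, if x.2 0 = false then
        ((activate (A.prog .snd η 0) (A.work η) (I.inbox I.rounds) 1).apply
          (partialTrace (stateAfter A Z η V I.rounds)) x x).re else 0 := by
    intro V
    rw [← Channel.partialTrace_onLeft_apply, probZero, Fintype.sum_prod_type]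
    refine Finset.sum_congr rfl fun x _ => ?_
    split_ifs <;> simp [partialTrace, Complex.re_sum]
  rw [key, key, partialTrace_stateAfter A Z η W W' _ h]

/-- In a round without an answer, nothing but the trace survives. -/
theorem World.answers_of_recv_eq_zero (W : World I nY) {i : ℕ} (hi : I.recv i = 0) :
    W.Answers i fun ρ => Matrix.of fun _ _ => ρ.trace := by
  intro σ
  have : Subsingleton (Word (I.recv i)) := by rw [hi]; infer_instance
  have : Unique (Word (I.recv i)) := Unique.mk' _
  ext r r'
  change _ = (partialTrace σ).trace
  rw [Subsingleton.elim r' r, trace_partialTrace, ← (W.step i).trace_apply,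
    ← trace_partialTrace, Matrix.trace, Fintype.sum_unique]
  exact congrArg (fun v => partialTrace _ v v) (Subsingleton.elim r _)

end Indistinguishable

/-! ### Constant families of circuits are uniform -/

section Uniform

variable {α β : Type}

/-- The program that pushes the list `l` onto the output stack and halts. -/
def pushAll (l : List β) : Turing.TM2.Stmt (fun b : Bool => cond b β α) Unit Bool :=
  l.foldl (fun q b => .push true (fun _ => b) q) .halt

/-- The machine that empties its input stack and prints the list `l`. Its internal state
records whether the last pop has found a symbol. -/
def constComputer [Fintype α] (l : List β) : Turing.FinTM2 where
  K := Bool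
  k₀ := false
  k₁ := true
  Γ := fun b => cond b β α
  Λ := Unit
  main := ()
  σ := Bool
  initialState := false
  Γk₀Fin := inferInstanceAs (Fintype α)
  m _ := .pop false (fun _ o => o.isSome) (.branch id (.goto fun _ => ()) (pushAll l))

/-- The stacks with input `s` and output `t`. -/
def ioStacks (s : List α) (t : List β) : ∀ b : Bool, List (cond b β α)
  | false => s
  | true => t

theorem update_ioStacks_false (s s' : List α) (t : List β) :
    Function.update (ioStacks s t) false s' = ioStacks s' t := by
  funext b
  cases b <;> rfl

theorem update_ioStacks_true (s : List α) (t t' : List β) :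
    Function.update (ioStacks s t) true t' = ioStacks s t' := by
  funext b
  cases b <;> rfl

theorem stepAux_pushAll (l t : List β) (v : Bool) (s : List α) :
    Turing.TM2.stepAux (pushAll l) v (ioStacks s t) = ⟨none, v, ioStacks s (l ++ t)⟩ := by
  suffices h : ∀ (q : Turing.TM2.Stmt (fun b : Bool => cond b β α) Unit Bool),
      Turing.TM2.stepAux (l.foldl (fun q b => .push true (fun _ => b) q) q) v (ioStacks s t)
        = Turing.TM2.stepAux q v (ioStacks s (l ++ t)) from h _
  induction l with
  | nil => intro q; rfl
  | cons b l ih =>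
    intro q
    rw [List.foldl_cons, ih]
    exact congrArg _ (update_ioStacks_true s (l ++ t) (b :: (l ++ t)))

theorem constComputer_evals [Fintype α] (l : List β) (s : List α) (v : Bool) :
    (flip bind (constComputer l).step)^[s.length + 1]
        (some (⟨some (), v, ioStacks s []⟩ : (constComputer (α := α) l).Cfg))
      = some ⟨none, false, ioStacks [] l⟩ := by
  induction s generalizing v with
  | nil =>
    change some (Turing.TM2.stepAux (pushAll l) false
      (Function.update (ioStacks [] []) false [])) = _
    rw [update_ioStacks_false, stepAux_pushAll, List.append_nil]
    rfl
  | cons a s ih =>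
    rw [List.length_cons, Function.iterate_succ_apply]
    have h : flip bind (constComputer l).step
        (some (⟨some (), v, ioStacks (a :: s) []⟩ : (constComputer (α := α) l).Cfg))
        = some ⟨some (), true, ioStacks s []⟩ := by
      exact congrArg (fun S => some (⟨some (), true, S⟩ : (constComputer (α := α) l).Cfg))
        (update_ioStacks_false (a :: s) s [])
    rw [h]
    exact ih true

theorem polyTimeUniform_const (C : Circuit) : PolyTimeUniform fun _ _ => C :=
  ⟨{ tm := constComputer (α := Bool ⊕ Bool) (encodeCircuit C)
     inputAlphabet := Equiv.refl _
     outputAlphabet := Equiv.refl _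
     time := Polynomial.X + 1
     outputsFun := fun a =>
      { steps := (encodeStage a).length + 1
        evals_in_steps := by
          have h := constComputer_evals (encodeCircuit C) (encodeStage a) false
          refine Eq.trans (congrArg _ (congrArg some ?_)) (h.trans (congrArg some ?_))
          · rw [Turing.initList]
            congr 1
            funext b
            cases b
            · exact List.map_id _
            · rfl
          · rw [Turing.haltList]
            congr 1
            funext b
            cases b
            · rfl
            · exact (List.map_id _).symm
        steps_le_m := by simp } }⟩

end Uniform

/-! ### Circuits that permute the basis states -/

theorem cnot_unitary {Q : Type} [Fintype Q] [DecidableEq Q] {c d : Q} (h : c ≠ d) :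
    ((Gate.cnot c d).unitary : Matrix (Q → Bool) (Q → Bool) ℂ) = basisMatrix (cnotMap c d) := by
  rw [Gate.unitary, dif_pos h]
  rfl

theorem cnotMap_injective {Q : Type} [DecidableEq Q] {c d : Q} (h : c ≠ d) :
    Function.Injective (cnotMap c d) := by
  refine Function.Involutive.injective fun x => ?_
  by_cases hx : x c <;> simp [cnotMap, hx, flipBit, h]

/-- The effect of an activation on basis states, when its circuit maps basis states to basis
states by `g`: the new private memory and the answer, and the discarded rest. -/
def activateMap {w m n : ℕ}
    (g : (Fin w ⊕ (Fin m ⊕ Fin n) → Bool) → (Fin w ⊕ (Fin m ⊕ Fin n) → Bool))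
    (x : Word w × Word m) : (Word w × Word n) × Word m :=
  let z := g (joinRegs w m n (x, zeroWord n))
  ((fun j => z (.inl j), fun j => z (.inr (.inr j))), fun j => z (.inr (.inl j)))

theorem activateMap_injective {w m n : ℕ}
    {g : (Fin w ⊕ (Fin m ⊕ Fin n) → Bool) → (Fin w ⊕ (Fin m ⊕ Fin n) → Bool)}
    (hg : Function.Injective g) : Function.Injective (activateMap g) := by
  intro x x' h
  simp only [activateMap, Prod.mk.injEq, funext_iff] at h
  have hz : g (joinRegs w m n (x, zeroWord n)) = g (joinRegs w m n (x', zeroWord n)) := by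
    funext a
    rcases a with a | a | a
    exacts [h.1.1 a, h.2 a, h.1.2 a]
  exact congrArg Prod.fst ((joinRegs w m n).injective (hg hz))

/-- The diagonal of a matrix moves along an injective map of basis states: a component of the
value is distributed as if the map were classical. -/
theorem sum_basisMatrix_conj {X S O R : Type} [Fintype X] [DecidableEq S] [Fintype O]
    [DecidableEq O] [Fintype R] [DecidableEq R] {h : X → (S × O) × R}
    (hh : Function.Injective h) (τ : Matrix X X ℂ) (s : S) :
    ∑ o, ∑ r, (basisMatrix h * τ * (basisMatrix h).conjTranspose) ((s, o), r) ((s, o), r)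
      = ∑ x, if s = (h x).1.1 then τ x x else 0 := by
  classical
  have e : ∀ o r, (basisMatrix h * τ * (basisMatrix h).conjTranspose) ((s, o), r) ((s, o), r)
      = ∑ x, if ((s, o), r) = h x then τ x x else 0 := by
    intro o r
    rw [basisMatrix_conj_apply]
    refine Finset.sum_congr rfl fun x _ => ?_
    by_cases hx : ((s, o), r) = h x
    · simp [hx, hh.eq_iff]
    · simp [hx]
  simp only [e]
  simp only [Finset.sum_comm (s := Finset.univ (α := R))]
  rw [Finset.sum_comm]
  refine Finset.sum_congr rfl fun x _ => ?_
  simp [Prod.ext_iff, ite_and]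

/-- An activation by a circuit that maps basis states to basis states is `activateMap`, extended
linearly, followed by discarding the rest of the received message. -/
theorem activate_apply {C : Circuit} {w m n : ℕ}
    {g : (Fin w ⊕ (Fin m ⊕ Fin n) → Bool) → (Fin w ⊕ (Fin m ⊕ Fin n) → Bool)}
    (hC : (C.unitary w m n : Matrix _ _ ℂ) = basisMatrix g)
    (τ : Matrix (Word w × Word m) (Word w × Word m) ℂ) :
    (activate C w m n).apply τ = partialTrace
      (basisMatrix (activateMap g) * τ * (basisMatrix (activateMap g)).conjTranspose) := by
  have hcomp : ∀ {X Y Z : Type} [Fintype X] [Fintype Y] [DecidableEq Y] [DecidableEq Z]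
      (a : Y → Z) (b : X → Y) (ρ : Matrix X X ℂ),
      basisMatrix a * (basisMatrix b * ρ * (basisMatrix b).conjTranspose)
          * (basisMatrix a).conjTranspose
        = basisMatrix (a ∘ b) * ρ * (basisMatrix (a ∘ b)).conjTranspose := by
    intro X Y Z _ _ _ _ a b ρ
    rw [← basisMatrix_mul, Matrix.conjTranspose_mul]
    simp only [Matrix.mul_assoc]
  rw [activate, Channel.seq_apply, Channel.seq_apply, Channel.seq_apply,
    Channel.discardRight_apply, Channel.ofEquiv, Channel.ofInjective_apply,
    Channel.ofUnitary_apply, hC]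
  -- `activate` states the injectivity of `joinRegs` only up to unfolding `Function.Injective`.
  erw [Channel.ofInjective_apply]
  rw [hcomp, hcomp]
  rfl

/-! ### The Simulator of the oblivious transfers -/

/-- On a message of the Adversary: if the stored flag is set, call the functionality with
`Abort`; then put the flag of the message into the private qubit, using the message
register, which is about to be discarded, to get rid of its former content. -/
def receiveFlag : Circuit :=
  [.cnot (.work, 0) (.out, 0), .cnot (.work, 0) (.out, 1),
    .cnot (.work, 0) (.inp, 0), .cnot (.inp, 0) (.work, 0)]

/-- The answer to the Adversary: a copy of the stored flag. -/
def sendFlag : Circuit := [.cnot (.work, 0) (.out, 0)]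

/-- The Simulator keeps the abort flag of the latest oblivious transfer in a single private
qubit, returns a copy of it, and passes `Abort` on to the functionality in the next
round. -/
def flagSimulator : BQPMachine where
  work _ := 1
  work_poly := ⟨1, fun _ => by simp⟩
  prog
    | .fst => fun _ _ => receiveFlag
    | .snd => fun _ _ => sendFlag
  uniform
    | .fst => polyTimeUniform_const _
    | .snd => polyTimeUniform_const _

/-- After `receiveFlag` the private qubit holds the flag of the message, regardless of its
former content. Only the diagonal matters because a copy of the flag stays behind. -/
theorem sum_activate_receiveFlag {m n : ℕ} (hm : 0 < m)
    (τ : Matrix (Word 1 × Word m) (Word 1 × Word m) ℂ) (s : Word 1) :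
    ∑ o, (activate receiveFlag 1 m (2 + n)).apply τ (s, o) (s, o)
      = ∑ x : Word 1 × Word m, if s = (fun _ => x.2 ⟨0, hm⟩) then τ x x else 0 := by
  let q : Fin 1 ⊕ (Fin m ⊕ Fin (2 + n)) := .inl 0
  let i : Fin 1 ⊕ (Fin m ⊕ Fin (2 + n)) := .inr (.inl ⟨0, hm⟩)
  let o₀ : Fin 1 ⊕ (Fin m ⊕ Fin (2 + n)) := .inr (.inr ⟨0, by omega⟩)
  let o₁ : Fin 1 ⊕ (Fin m ⊕ Fin (2 + n)) := .inr (.inr ⟨1, by omega⟩)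
  let g := cnotMap i q ∘ cnotMap q i ∘ cnotMap q o₁ ∘ cnotMap q o₀
  have hC : (receiveFlag.unitary 1 m (2 + n) : Matrix _ _ ℂ) = basisMatrix g := by
    have : receiveFlag.filterMap (resolveGate 1 m (2 + n))
        = [.cnot q o₀, .cnot q o₁, .cnot q i, .cnot i q] := by
      have hq : resolve 1 m (2 + n) (.work, 0) = some q := by simp [resolve, q]
      have hi : resolve 1 m (2 + n) (.inp, 0) = some i := dif_pos hm
      have h₀ : resolve 1 m (2 + n) (.out, 0) = some o₀ := dif_pos (by omega)
      have h₁ : resolve 1 m (2 + n) (.out, 1) = some o₁ := dif_pos (by omega)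
      simp [receiveFlag, resolveGate, hq, hi, h₀, h₁]
    rw [Circuit.unitary, this]
    simp only [List.map_cons, List.map_nil, List.reverse_cons, List.reverse_nil, List.nil_append,
      List.cons_append, List.prod_cons, List.prod_nil, mul_one, Submonoid.coe_mul]
    rw [cnot_unitary (by simp [q, i]), cnot_unitary (by simp [q, i]),
      cnot_unitary (by simp [q, o₁]), cnot_unitary (by simp [q, o₀])]
    simp only [basisMatrix_mul, g]
  have hq : ∀ x, (activateMap g x).1.1 0 = x.2 ⟨0, hm⟩ := by
    intro x
    change g (joinRegs 1 m (2 + n) (x, zeroWord _)) q = joinRegs 1 m (2 + n) (x, zeroWord _) i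
    generalize joinRegs 1 m (2 + n) (x, zeroWord _) = z
    by_cases h : z q <;> by_cases h' : z i <;>
      simp [g, cnotMap, flipBit, q, i, o₀, o₁, h, h', Function.update]
  have hinj : Function.Injective g :=
    (cnotMap_injective (by simp [q, i])).comp ((cnotMap_injective (by simp [q, i])).comp
      ((cnotMap_injective (by simp [q, o₁])).comp (cnotMap_injective (by simp [q, o₀]))))
  rw [activate_apply hC]
  refine (sum_basisMatrix_conj (activateMap_injective hinj) τ s).trans ?_
  refine Finset.sum_congr rfl fun x _ => if_congr ?_ rfl rfl
  rw [← hq x, funext_iff, funext_iff, Fin.forall_fin_one, Fin.forall_fin_one]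

/-- After `sendFlag` both the answer and the retained private qubit hold the flag, so the answer
alone is in a classical state: tracing out the private qubit measures the flag. -/
theorem sum_activate_sendFlag {m n : ℕ} (hn : n = 1)
    (τ : Matrix (Word 1 × Word m) (Word 1 × Word m) ℂ) (r r' : Word n) :
    ∑ s, (activate sendFlag 1 m n).apply τ (s, r) (s, r')
      = ∑ s : Word 1, if r = (fun _ => s 0) ∧ r' = (fun _ => s 0) then
          ∑ c, τ (s, c) (s, c) else 0 := by
  subst hn
  let q : Fin 1 ⊕ (Fin m ⊕ Fin 1) := .inl 0
  let o : Fin 1 ⊕ (Fin m ⊕ Fin 1) := .inr (.inr 0)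
  have hC : (sendFlag.unitary 1 m 1 : Matrix _ _ ℂ) = basisMatrix (cnotMap q o) := by
    have : sendFlag.filterMap (resolveGate 1 m 1) = [.cnot q o] := by
      simp [sendFlag, resolveGate, resolve, q, o]
    rw [Circuit.unitary, this]
    simp only [List.map_cons, List.map_nil, List.reverse_cons, List.reverse_nil, List.nil_append,
      List.prod_cons, List.prod_nil, mul_one]
    exact cnot_unitary (by simp [q, o])
  have hmap : ∀ x : Word 1 × Word m,
      activateMap (cnotMap q o) x = ((x.1, fun _ => x.1 0), x.2) := by
    intro x
    have e : joinRegs 1 m 1 (x, zeroWord 1) o = false := rfl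
    have eq : joinRegs 1 m 1 (x, zeroWord 1) q = x.1 0 := rfl
    refine Prod.ext (Prod.ext (funext fun j => ?_) (funext fun j => ?_)) (funext fun j => ?_)
    · change cnotMap q o _ (.inl j) = joinRegs 1 m 1 (x, zeroWord 1) (.inl j)
      unfold cnotMap flipBit
      split_ifs <;> simp [o]
    · rw [Subsingleton.elim j 0]
      change cnotMap q o _ o = x.1 0
      cases h : x.1 0 <;> simp [cnotMap, flipBit, e, eq, h]
    · change cnotMap q o _ (.inr (.inl j)) = joinRegs 1 m 1 (x, zeroWord 1) (.inr (.inl j))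
      unfold cnotMap flipBit
      split_ifs <;> simp [o]
  rw [activate_apply hC]
  simp only [partialTrace, Matrix.of_apply, basisMatrix_conj_apply, hmap]
  refine Finset.sum_congr rfl fun s _ => ?_
  have e : ∀ c, (∑ x : Word 1 × Word m, ∑ x' : Word 1 × Word m,
      if ((s, r), c) = ((x.1, fun _ => x.1 0), x.2) ∧
        ((s, r'), c) = ((x'.1, fun _ => x'.1 0), x'.2) then τ x x' else 0)
      = if r = (fun _ => s 0) ∧ r' = (fun _ => s 0) then τ (s, c) (s, c) else 0 := by
    intro c
    rw [Finset.sum_eq_single (s, c), Finset.sum_eq_single (s, c)]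
    · simp
    · rintro x' - hx'
      exact if_neg fun h => hx' (Prod.ext (congrArg (·.1.1) h.2).symm (congrArg (·.2) h.2).symm)
    · simp
    · rintro x - hx
      exact Finset.sum_eq_zero fun x' _ => if_neg fun h =>
        hx (Prod.ext (congrArg (·.1.1) h.1).symm (congrArg (·.2) h.1).symm)
    · simp
  refine (Finset.sum_congr rfl fun c _ => e c).trans ?_
  split_ifs <;> simp

namespace Channel

variable {M S Q F P R : Type} [Fintype M] [DecidableEq M] [Fintype S] [DecidableEq S]
  [Fintype Q] [DecidableEq Q] [Fintype F] [DecidableEq F] [Fintype P] [DecidableEq P]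
  [Fintype R] [DecidableEq R]

/-- A simulator with memory `S` between the Adversary and a functionality with memory `F`:
it turns a message into a query by `a`, and the reply to the query into an answer by `b`. -/
def relay (a : Channel (S × M) (S × Q)) (Φ : Channel (Q × F) (P × F))
    (b : Channel (S × P) (S × R)) : Channel (M × (S × F)) (R × (S × F)) :=
  ((ofEquiv (⟨fun x => ((x.2.1, x.1), x.2.2), fun x => (x.1.2, (x.1.1, x.2)),
      fun _ => rfl, fun _ => rfl⟩ : M × (S × F) ≃ (S × M) × F)).seq
    (a.onLeft.seq (ofEquiv (Equiv.prodAssoc _ _ _)))).seq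
  ((Φ.onRight.seq (ofEquiv (Equiv.prodAssoc _ _ _).symm)).seq
    (b.onLeft.seq (ofEquiv (⟨fun x => (x.1.2, (x.1.1, x.2)), fun x => ((x.2.1, x.1), x.2.2),
      fun _ => rfl, fun _ => rfl⟩ : (S × R) × F ≃ R × (S × F)))))

/-- If the simulator answers with a copy `w` of a classical value `k` of the message that it
retains, then the message is answered as by a measurement of that value, whatever the
functionality does. -/
theorem partialTrace_relay_apply {a : Channel (S × M) (S × Q)} {Φ : Channel (Q × F) (P × F)}
    {b : Channel (S × P) (S × R)} {k : M → S} {w : S → R}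
    (ha : ∀ τ s, ∑ o, a.apply τ (s, o) (s, o) = ∑ x, if s = k x.2 then τ x x else 0)
    (hb : ∀ τ r r', ∑ s, b.apply τ (s, r) (s, r')
      = ∑ s, if r = w s ∧ r' = w s then ∑ c, τ (s, c) (s, c) else 0)
    (σ : Matrix (M × (S × F)) (M × (S × F)) ℂ) :
    partialTrace ((relay a Φ b).apply σ) = (classical fun c => w (k c)).apply (partialTrace σ) := by
  let ρ₀ : Matrix ((S × M) × F) ((S × M) × F) ℂ :=
    Matrix.of fun x x' => σ (x.1.2, (x.1.1, x.2)) (x'.1.2, (x'.1.1, x'.2))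
  let ρ₁ := (a.onLeft.apply ρ₀).submatrix (Equiv.prodAssoc S Q F).symm (Equiv.prodAssoc S Q F).symm
  let ρ₂ := (Φ.onRight.apply ρ₁).submatrix (Equiv.prodAssoc S P F) (Equiv.prodAssoc S P F)
  have hrelay : ∀ r r' s t, (relay a Φ b).apply σ (r, (s, t)) (r', (s, t))
      = b.onLeft.apply ρ₂ ((s, r), t) ((s, r'), t) := by
    intro r r' s t
    simp only [relay, seq_apply, ofEquiv_apply]
    rfl
  have h₁ : ∀ s, ∑ c, partialTrace ρ₂ (s, c) (s, c) = ∑ x, if s = k x.2 then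
      partialTrace ρ₀ x x else 0 := by
    intro s
    rw [← ha, ← partialTrace_onLeft_apply]
    have h := congrFun (congrFun (partialTrace_onRight_apply Φ ρ₁) s) s
    simp only [partialTrace, Matrix.of_apply, Fintype.sum_prod_type] at h
    exact h
  ext r r'
  have h₂ : partialTrace ((relay a Φ b).apply σ) r r'
      = ∑ s, b.apply (partialTrace ρ₂) (s, r) (s, r') := by
    rw [← partialTrace_onLeft_apply]
    simp only [partialTrace, Matrix.of_apply, Fintype.sum_prod_type, hrelay]
  rw [h₂, hb, classical_apply]
  simp only [h₁, Fintype.sum_prod_type]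
  have h₃ : ∀ c, partialTrace σ c c = ∑ s, partialTrace ρ₀ (s, c) (s, c) := fun c => by
    simp only [partialTrace, Matrix.of_apply, Fintype.sum_prod_type, ρ₀]
  calc _ = ∑ s, ∑ c, if s = k c then (if r = w s ∧ r' = w s then
          ∑ s₀, partialTrace ρ₀ (s₀, c) (s₀, c) else 0) else 0 := by
        refine Finset.sum_congr rfl fun s _ => ?_
        rw [Finset.sum_comm]
        split_ifs
        · refine Finset.sum_congr rfl fun c _ => ?_
          split_ifs <;> simp
        · simp
    _ = _ := by
        rw [Finset.sum_comm]
        refine Finset.sum_congr rfl fun c _ => ?_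
        rw [Finset.sum_ite_eq' Finset.univ (k c), if_pos (Finset.mem_univ _), h₃]

end Channel

/-! ### The answers in the two worlds -/

section Answers

variable {nX nY nK nA p : ℕ}

/-- The position of the abort flag in a message to an oblivious transfer. -/
def flagIndex {i : ℕ} (h : i < nY) : Fin ((yaoInterface nX nY nK nA p).send i) :=
  Fin.cast (if_pos h : _ = 1 + (nK + nK)).symm (Fin.castAdd _ 0)

/-- What the Garbler sees of the `i`-th oblivious transfer: the abort flag is measured and
returned. -/
def flagAnswer {i : ℕ} (h : i < nY) :
    Channel (Word ((yaoInterface nX nY nK nA p).send i))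
      (Word ((yaoInterface nX nY nK nA p).recv i)) :=
  Channel.classical fun c _ => c (flagIndex h)

theorem otMap_fst {n r : ℕ} (hn : n = 1 + (nK + nK)) (i : Fin nY)
    (s : Word n × EvalMem nX nY nK nA p) :
    (otMap hn i s : Word r × EvalMem nX nY nK nA p).1
      = fun _ => s.1 (Fin.cast hn.symm (Fin.castAdd _ 0)) := by
  cases h : s.1 (Fin.cast hn.symm (Fin.castAdd _ 0)) <;> simp [otMap, h]

theorem yaoEvaluator_answers (E : EncScheme nK nA (p + 1)) {i : ℕ} (h : i < nY) :
    (yaoEvaluator E : World (yaoInterface nX nY nK nA p) nY).Answers i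
      (flagAnswer h).apply := by
  intro σ
  have hstep : (yaoEvaluator E : World (yaoInterface nX nY nK nA p) nY).step i
      = Channel.classical (otMap (if_pos h) ⟨i, h⟩) := dif_pos h
  rw [hstep]
  exact Channel.partialTrace_classical_apply (fun s => otMap_fst (if_pos h) ⟨i, h⟩ s) σ

theorem partialTrace_relay_flag_apply (f : Word nX → Word nY → Bool) {i : ℕ} (h : i < nY)
    (σ : Matrix (Word ((yaoInterface nX nY nK nA p).send i) × (Word 1 × (sfe f).Mem))
      (Word ((yaoInterface nX nY nK nA p).send i) × (Word 1 × (sfe f).Mem)) ℂ) :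
    partialTrace ((Channel.relay (activate receiveFlag 1 _ (2 + nX)) (sfe f).step
      (activate sendFlag 1 (2 + nX) ((yaoInterface nX nY nK nA p).recv i))).apply σ)
      = (flagAnswer h).apply (partialTrace σ) := by
  -- The flag is the first qubit of the message, the one that `receiveFlag` reads.
  have hpos := (flagIndex (nX := nX) (nK := nK) (nA := nA) (p := p) h).pos
  have hrecv : (yaoInterface nX nY nK nA p).recv i = 1 := if_pos h
  have := Channel.partialTrace_relay_apply (Φ := (sfe f).step)
    (k := fun c _ => c (flagIndex h)) (w := fun s _ => s 0)
    (sum_activate_receiveFlag hpos) (sum_activate_sendFlag (m := 2 + nX) hrecv) σ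
  exact this

theorem flagSimulator_answers {η : ℕ} (f : Word nX → Word nY → Bool) {i : ℕ} (h : i < nY) :
    (idealWorld flagSimulator η (sfe f) : World (yaoInterface nX nY nK nA p) nY).Answers i
      (flagAnswer h).apply :=
  fun σ => partialTrace_relay_flag_apply f h σ

end Answers

end SupYao
end

/-- Perfect security (`ε = 0`) of the superposition-resistant Yao protocol against a `BQP`
adversarial Garbler in the OT-hybrid model. -/
theorem mainTheorem2 (nX nY nK nA p : ℕ → ℕ)
    (f : ∀ η, SupYao.Word (nX η) → SupYao.Word (nY η) → Bool)
    (E : ∀ η, SupYao.EncScheme (nK η) (nA η) (p η + 1)) :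
    SupYao.SecurelyEmulates
      (I := fun η => SupYao.yaoInterface (nX η) (nY η) (nK η) (nA η) (p η))
      (fun η => SupYao.yaoEvaluator (E η)) (fun η => SupYao.sfe (f η)) (fun _ => 0) := by
  refine ⟨tendsto_const_nhds, fun A Z => ⟨SupYao.flagSimulator, fun η => ?_⟩⟩
  rw [SupYao.probZero_eq A Z η (SupYao.idealWorld SupYao.flagSimulator η (SupYao.sfe (f η)))
    (SupYao.yaoEvaluator (E η)), sub_self, abs_zero]
  intro i _
  -- The rounds `i < nY η` are the oblivious transfers; in the last one there is no answer.
  by_cases h : i < nY η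
  · exact ⟨_, SupYao.flagSimulator_answers (f η) h, SupYao.yaoEvaluator_answers (E η) h⟩
  · exact ⟨_, SupYao.World.answers_of_recv_eq_zero _ (if_neg h),
      SupYao.World.answers_of_recv_eq_zero _ (if_neg h)⟩
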